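/- Let $E$ be a Dedekind complete $\Phi$-algebra, i.e. a Dedekind complete real vector lattice with an associative unital multiplication such that products of positive elements are positive and $x\wedge y=0$, $z\ge 0$ imply $(zx)\wedge y=(xz)\wedge y=0$. Write $u\ll v$ if $v-u$ is a weak order unit (a positive element disjoint only from $0$), $[a,b]=\{x: a\le x\le b\}$ and $(a,b)=\{x: a\ll x\ll b\}$. A net $(x_\alpha)$ converges in order to $x$, written $x_\alpha\to x$, if there is a set $\mathcal E\subseteq E$ with infimum $0$ such that for every $\varepsilon\in\mathcal E$ eventually $|x_\alpha-x|\le\varepsilon$. For $D\subseteq E$, a function $f\colon D\to E$ is order continuous if $x_\alpha\to c$ in $D$ with $c\in D$ implies $f(x_\alpha)\to f(c)$; uniformly order continuous if $x_\alpha-y_\alpha\to0$ with $x_\alpha,y_\alpha\in D$ implies $f(x_\alpha)-f(y_\alpha)\to0$; and locally band preserving if $P(x)=P(y)$ implies $P(f(x))=P(f(y))$ for every band projection $P$ and all $x,y\in D$. It is super order differentiable at $c\in D$ with derivative $f'(c)$ if there is a weak order unit $r$ with $(c-r,c+r)\subseteq D$, and for every downwards directed $\Delta\subseteq E$ with infimum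 $0$ there is $\mathcal E\subseteq E$ with infimum $0$ such that for every $\varepsilon\in\mathcal E$ there is $\delta\in\Delta$ with $$x\in D,\ |x-c|\le\delta \implies |f(x)-f(c)-(x-c)f'(c)|\le|x-c|\,\varepsilon.$$ For $a\le b$, an order bounded $f\colon[a,b]\to E$ is integrable if its lower integral $\sup_P\sum_i \inf f([x_{i-1},x_i])\,(x_i-x_{i-1})$ and its upper integral $\inf_P\sum_i \sup f([x_{i-1},x_i])\,(x_i-x_{i-1})$, taken over all finite chains $P=\{a=x_0\le x_1\le\dots\le x_n=b\}$, agree; the common value is $\int_a^b f$. **Theorem (Fundamental Theorem of Calculus, part 1).** Let $a\ll b$ in $E$, and let $f\colon[a,b]\to E$ be order continuous, locally band preserving and integrable. Then $f$ is integrable on $[a,x]$ for every $x\in[a,b]$, and the function $F\colon[a,b]\to E$, $F(x)=\int_a^x f(z)\,dz$, is uniformly order continuous on $[a,b]$ and super order differentiable at every $c\in(a,b)$ with $F'(c)=f(c)$. -/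

import Mathlib

universe u

namespace VectorLattice

/-- A `Φ`-algebra (unital `f`-algebra): a real vector lattice with an associative unital
multiplication for which products of positive elements are positive, and such that
multiplication by positive elements preserves disjointness in the sense that
`x ⊓ y = 0` and `0 ≤ z` imply `(z * x) ⊓ y = 0` and `(x * z) ⊓ y = 0`.
Commutativity and `0 ≤ 1` are not part of the definition.
Dedekind completeness is expressed separately by `ConditionallyCompleteLattice`. -/
class PhiAlgebra (E : Type u) [Ring E] [Lattice E] [Algebra ℝ E] : Prop
    extends IsOrderedAddMonoid E, IsOrderedModule ℝ E where
  protected mul_nonneg : ∀ x y : E, 0 ≤ x → 0 ≤ y → 0 ≤ x * y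
  mul_left_inf : ∀ x y z : E, x ⊓ y = 0 → 0 ≤ z → (z * x) ⊓ y = 0
  mul_right_inf : ∀ x y z : E, x ⊓ y = 0 → 0 ≤ z → (x * z) ⊓ y = 0

section Bands

variable {E : Type u} [AddCommGroup E] [Lattice E] [Module ℝ E]

/-- `x` and `y` are disjoint. -/
def IsDisjoint (x y : E) : Prop := |x| ⊓ |y| = 0

/-- A band: a solid linear subspace that contains every supremum, existing in `E`, of
a subset of it. -/
structure IsBand (B : Submodule ℝ E) : Prop where
  solid : ∀ x ∈ B, ∀ y : E, |y| ≤ |x| → y ∈ B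
  sup_mem : ∀ S : Set E, S ⊆ B → ∀ s : E, IsLUB S s → s ∈ B

/-- `P` is the band projection onto some band `B`: every `x` is the sum of `P x ∈ B` and
of `x - P x`, which belongs to the disjoint complement of `B`. -/
def IsBandProjection (P : E →ₗ[ℝ] E) : Prop :=
  ∃ B : Submodule ℝ E, IsBand B ∧ ∀ x : E, P x ∈ B ∧ ∀ y ∈ B, IsDisjoint (x - P x) y

/-- `f` is locally band preserving on its domain `D`. -/
def LocallyBandPreservingOn (f : E → E) (D : Set E) : Prop :=
  ∀ P : E →ₗ[ℝ] E, IsBandProjection P →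
    ∀ x ∈ D, ∀ y ∈ D, P x = P y → P (f x) = P (f y)

end Bands

section Order

variable {E : Type u} [AddCommGroup E] [Lattice E]

/-- A weak order unit: a positive element disjoint only from `0`. -/
def IsWeakOrderUnit (e : E) : Prop := 0 ≤ e ∧ ∀ x : E, IsDisjoint x e → x = 0

/-- `a ≪ b`: the difference `b - a` is a weak order unit. -/
def WeakUnitLT (a b : E) : Prop := IsWeakOrderUnit (b - a)

/-- The order open interval `{x | a ≪ x ≪ b}`. -/
def openInterval (a b : E) : Set E := {x | WeakUnitLT a x ∧ WeakUnitLT x b}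

/-- `Δ ↓ 0`: a (nonempty) downwards directed set with infimum `0`. -/
structure DecreasesToZero (Δ : Set E) : Prop where
  nonempty : Δ.Nonempty
  directed : DirectedOn (fun x y => y ≤ x) Δ
  isGLB : IsGLB Δ 0

/-- Order convergence of the net `x` to `l`: there is a set `S` with infimum `0` each of
whose elements eventually dominates `|x i - l|`. -/
def OrderConverges {ι : Type u} [Preorder ι] (x : ι → E) (l : E) : Prop :=
  ∃ S : Set E, IsGLB S 0 ∧ ∀ ε ∈ S, ∃ i₀ : ι, ∀ i, i₀ ≤ i → |x i - l| ≤ ε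

/-- `f`, with domain `D`, is order continuous at every point of `D`: it preserves limits of
order convergent nets in `D`. -/
def OrderContinuousOn (f : E → E) (D : Set E) : Prop :=
  ∀ c ∈ D, ∀ (ι : Type u) [Preorder ι] [IsDirectedOrder ι] [Nonempty ι] (x : ι → E),
    (∀ i, x i ∈ D) → OrderConverges x c → OrderConverges (fun i => f (x i)) (f c)

/-- `f`, with domain `D`, is uniformly order continuous. -/
def UniformlyOrderContinuousOn (f : E → E) (D : Set E) : Prop :=
  ∀ (ι : Type u) [Preorder ι] [IsDirectedOrder ι] [Nonempty ι] (x y : ι → E),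
    (∀ i, x i ∈ D) → (∀ i, y i ∈ D) → OrderConverges (fun i => x i - y i) 0 →
      OrderConverges (fun i => f (x i) - f (y i)) 0

end Order

/-- `f`, with domain `D`, is super order differentiable at `c ∈ D` with derivative `f'`. -/
def HasSuperOrderDerivAt {E : Type u} [Ring E] [Lattice E]
    (f : E → E) (D : Set E) (f' c : E) : Prop :=
  c ∈ D ∧ ∃ r : E, IsWeakOrderUnit r ∧ openInterval (c - r) (c + r) ⊆ D ∧
    ∀ Δ : Set E, DecreasesToZero Δ → ∃ S : Set E, IsGLB S 0 ∧ ∀ ε ∈ S, ∃ δ ∈ Δ,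
      ∀ x ∈ D, |x - c| ≤ δ → |f x - f c - (x - c) * f'| ≤ |x - c| * ε

/-- A partition `a = x₀ ≤ x₁ ≤ ⋯ ≤ xₙ = b` of the order interval `[a, b]`. -/
structure IntervalPartition {E : Type u} [Preorder E] (a b : E) where
  n : ℕ
  pt : Fin (n + 1) → E
  mono : Monotone pt
  first : pt 0 = a
  last : pt (Fin.last n) = b

section Integral

variable {E : Type u} [Ring E] [ConditionallyCompleteLattice E]

/-- The lower sum of `f` with respect to the partition `P`. -/
noncomputable def lowerSum (f : E → E) {a b : E} (P : IntervalPartition a b) : E :=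
  ∑ i : Fin P.n, sInf (f '' Set.Icc (P.pt i.castSucc) (P.pt i.succ)) *
    (P.pt i.succ - P.pt i.castSucc)

/-- The upper sum of `f` with respect to the partition `P`. -/
noncomputable def upperSum (f : E → E) {a b : E} (P : IntervalPartition a b) : E :=
  ∑ i : Fin P.n, sSup (f '' Set.Icc (P.pt i.castSucc) (P.pt i.succ)) *
    (P.pt i.succ - P.pt i.castSucc)

/-- The lower integral of `f` over `[a, b]`. -/
noncomputable def lowerIntegral (f : E → E) (a b : E) : E :=
  sSup (Set.range fun P : IntervalPartition a b => lowerSum f P)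

/-- The upper integral of `f` over `[a, b]`. -/
noncomputable def upperIntegral (f : E → E) (a b : E) : E :=
  sInf (Set.range fun P : IntervalPartition a b => upperSum f P)

/-- `f` is (Darboux) integrable on `[a, b]`, where `a ≤ b`: it is order bounded there (so that
the lower and upper sums are meaningful), and its upper and lower integrals agree. -/
structure IntegrableOn (f : E → E) (a b : E) : Prop where
  bddBelow : BddBelow (f '' Set.Icc a b)
  bddAbove : BddAbove (f '' Set.Icc a b)
  upper_eq_lower : upperIntegral f a b = lowerIntegral f a b

/-- The integral of `f` over `[a, b]`, for `f` integrable on `[a, b]`. -/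
noncomputable def integral (f : E → E) (a b : E) : E := upperIntegral f a b

end Integral

end VectorLattice

set_option linter.unusedSectionVars false

namespace VectorLattice

/-! ### Components of the unit, band projections, and commutativity of the multiplication. -/

section Components

variable {E : Type u} [Ring E] [ConditionallyCompleteLattice E] [Algebra ℝ E] [PhiAlgebra E]

/-! The classical estimate survives, but `x` and `c` need not be comparable. The increment of `F`
from `c` to `x` is the integral over `[x ⊓ c, x]` minus that over `[x ⊓ c, c]`, and the former
equals the integral over `[c, x ⊔ c]` (`upperIntegral_inf_left`). The two lengths `x ⊔ c - c` and `c
- x ⊓ c` have difference `x - c` and sum `|x - c|`. If `f` stays within `ε` of `k` on `[x ⊓ c, x ⊔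
c]`, then `F x - F c` is therefore within `|x - c| * ε` of `(x - c) * k`
(`abs_upperIntegral_sub_le`). Taking `k = f c` and using order continuity gives the derivative;
taking `k = 0` and a global bound gives uniform continuity.

Additivity and the identity above both come from cutting each link `[p, q]` of a chain into `[p ⊓ c,
q ⊓ c]` and `[p ⊔ c, q ⊔ c]` (`upperTerm_split`). These pieces need not lie in `[p, q]`. However,
the unit splits into two components: on one the piece lies inside `[p, q]`, on the other it has
length zero. Local band preservation allows the comparison of suprema on each component separately.

Beyond order bounds, integrability matters only for the subintervals: the gap between upper and
lower integral is additive and nonnegative, so it vanishes on `[a, x]` if it does on `[a, b]`.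
Commutativity of the multiplication is derived from the Archimedean property. -/

theorem mul_eq_zero_of_inf_eq_zero {x y : E} (h : x ⊓ y = 0) : x * y = 0 := by
  have hx : 0 ≤ x := h ▸ inf_le_left
  have hy : 0 ≤ y := h ▸ inf_le_right
  -- Multiplying `x` by `y`, then `y` by `x`, preserves disjointness and turns both entries into `x
  -- * y`.
  have h1 := PhiAlgebra.mul_right_inf x y y h hy
  rw [inf_comm] at h1
  simpa using PhiAlgebra.mul_left_inf y (x * y) x h1 hx

theorem mul_self_nonneg_of_phiAlgebra (x : E) : 0 ≤ x * x := by
  have h1 : x⁺ * x⁻ = 0 := mul_eq_zero_of_inf_eq_zero (posPart_inf_negPart_eq_zero x)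
  have h2 : x⁻ * x⁺ = 0 :=
    mul_eq_zero_of_inf_eq_zero (by rw [inf_comm]; exact posPart_inf_negPart_eq_zero x)
  have h3 : x * x = x⁺ * x⁺ + x⁻ * x⁻ := by
    conv_lhs => rw [← posPart_sub_negPart x]
    rw [sub_mul, mul_sub, mul_sub, h1, h2]
    abel
  rw [h3]
  exact add_nonneg (PhiAlgebra.mul_nonneg _ _ (posPart_nonneg x) (posPart_nonneg x))
    (PhiAlgebra.mul_nonneg _ _ (negPart_nonneg x) (negPart_nonneg x))

instance PhiAlgebra.toIsOrderedRing : IsOrderedRing E :=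
  haveI : ZeroLEOneClass E := ⟨by simpa using mul_self_nonneg_of_phiAlgebra (1 : E)⟩
  IsOrderedRing.of_mul_nonneg PhiAlgebra.mul_nonneg

theorem nonpos_of_forall_nsmul_le {w v : E} (h : ∀ n : ℕ, n • w ≤ v) : w ≤ 0 := by
  have hb : BddAbove (Set.range fun n : ℕ => n • w) := ⟨v, by rintro _ ⟨n, rfl⟩; exact h n⟩
  have h1 : sSup (Set.range fun n : ℕ => n • w) ≤ sSup (Set.range fun n : ℕ => n • w) - w := by
    refine csSup_le (Set.range_nonempty _) ?_
    rintro _ ⟨n, rfl⟩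
    rw [le_sub_iff_add_le, ← succ_nsmul]
    exact le_csSup hb ⟨n + 1, rfl⟩
  simpa using h1

theorem add_inf_eq_zero {x y v : E} (hx : x ⊓ v = 0) (hy : y ⊓ v = 0) : (x + y) ⊓ v = 0 := by
  have hx0 : 0 ≤ x := hx ▸ inf_le_left
  have hv0 : 0 ≤ v := hx ▸ inf_le_right
  have hy0 : 0 ≤ y := hy ▸ inf_le_left
  refine le_antisymm ?_ (le_inf (add_nonneg hx0 hy0) hv0)
  have h : (x + y) ⊓ v ≤ x ⊓ v + y ⊓ v := by
    rw [inf_add, add_inf]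
    refine le_inf (le_inf inf_le_left (inf_le_right.trans ?_)) (inf_le_right.trans ?_)
    · exact le_add_of_nonneg_left hx0
    · exact le_add_of_nonneg_right (le_inf hy0 hv0)
  simpa [hx, hy] using h

theorem inf_eq_zero_of_le {x y v : E} (hx : 0 ≤ x) (hxy : x ≤ y) (h : y ⊓ v = 0) :
    x ⊓ v = 0 :=
  le_antisymm (h ▸ inf_le_inf_right v hxy) (le_inf hx (h ▸ inf_le_right))

/-- A component of the unit. Multiplication by components gives band projections. -/
def IsComponent (e : E) : Prop := e ⊓ (1 - e) = 0

namespace IsComponent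

variable {e : E}

theorem nonneg (h : IsComponent e) : 0 ≤ e := h ▸ inf_le_left

theorem one_sub_nonneg (h : IsComponent e) : 0 ≤ 1 - e := h ▸ inf_le_right

theorem le_one (h : IsComponent e) : e ≤ 1 := sub_nonneg.1 h.one_sub_nonneg

theorem one_sub (h : IsComponent e) : IsComponent (1 - e) := by
  rw [IsComponent, inf_comm, sub_sub_cancel]
  exact h

theorem mul_self (h : IsComponent e) : e * e = e := by
  have h1 := mul_eq_zero_of_inf_eq_zero h
  rw [mul_sub, mul_one, sub_eq_zero] at h1
  exact h1.symm

theorem mul_mul_one_sub (h : IsComponent e) (y : E) : e * y * (1 - e) = 0 := by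
  have key : ∀ z : E, 0 ≤ z → e * z * (1 - e) = 0 := fun z hz =>
    mul_eq_zero_of_inf_eq_zero (PhiAlgebra.mul_right_inf _ _ z h hz)
  rw [← posPart_sub_negPart y, mul_sub e, sub_mul, key _ (posPart_nonneg y),
    key _ (negPart_nonneg y), sub_zero]

theorem commute (h : IsComponent e) (y : E) : e * y = y * e := by
  have h1 := h.mul_mul_one_sub y
  have h2 := h.one_sub.mul_mul_one_sub y
  rw [sub_sub_cancel, sub_mul, one_mul, sub_mul, sub_eq_zero] at h2
  rw [mul_sub, mul_one, sub_eq_zero] at h1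
  rw [h1, h2]

end IsComponent

/-- The projection onto the disjoint complement of `v`, given by a component of the unit. -/
theorem exists_isComponent_of_nonneg {v : E} (hv : 0 ≤ v) :
    ∃ e : E, IsComponent e ∧ e * v = 0 ∧ ∀ u : E, u ⊓ v = 0 → (1 - e) * u = 0 := by
  set Z : Set E := {z | 0 ≤ z ∧ z ≤ 1 ∧ z ⊓ v = 0} with hZ
  have hb : BddAbove Z := ⟨1, fun z hz => hz.2.1⟩
  have h0 : (0 : E) ∈ Z := ⟨le_rfl, zero_le_one, by simpa using hv⟩
  have he0 : 0 ≤ sSup Z := le_csSup hb h0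
  have he1 : sSup Z ≤ 1 := csSup_le ⟨0, h0⟩ fun z hz => hz.2.1
  have hev : sSup Z ⊓ v = 0 := by
    refine le_antisymm ?_ (le_inf he0 hv)
    -- For `z` disjoint from `v`, `z + v = z ⊔ v`; this passes to the supremum.
    have h1 : sSup Z ≤ sSup Z ⊔ v - v := by
      refine csSup_le ⟨0, h0⟩ fun z hz => ?_
      have h2 := inf_add_sup z v
      rw [hz.2.2, zero_add] at h2
      rw [le_sub_iff_add_le, ← h2]
      exact sup_le_sup_right (le_csSup hb hz) v
    have h2 := inf_add_sup (sSup Z) v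
    rw [← eq_sub_iff_add_eq] at h2
    rw [h2, sub_nonpos]
    exact le_sub_iff_add_le.1 h1
  have hmax : ∀ w : E, 0 ≤ w → w ≤ 1 - sSup Z → w ⊓ v = 0 → w ≤ 0 := by
    intro w hw hw1 hwv
    have : sSup Z + w ∈ Z :=
      ⟨add_nonneg he0 hw, by rwa [add_comm, ← le_sub_iff_add_le], add_inf_eq_zero hev hwv⟩
    simpa using le_csSup hb this
  have hs : 0 ≤ 1 - sSup Z := sub_nonneg.2 he1
  refine ⟨sSup Z, ?_, mul_eq_zero_of_inf_eq_zero hev, fun u hu => ?_⟩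
  · have hw : 0 ≤ sSup Z ⊓ (1 - sSup Z) := le_inf he0 hs
    exact le_antisymm (hmax _ hw inf_le_right (inf_eq_zero_of_le hw inf_le_left hev)) hw
  · have hw : 0 ≤ (1 - sSup Z) ⊓ u := le_inf hs (hu ▸ inf_le_left)
    exact mul_eq_zero_of_inf_eq_zero
      (le_antisymm (hmax _ hw inf_le_left (inf_eq_zero_of_le hw inf_le_right hu)) hw)

theorem exists_isComponent_split (d : E) :
    ∃ e : E, IsComponent e ∧ 0 ≤ e * d ∧ (1 - e) * d ≤ 0 := by
  obtain ⟨e, he, h1, h2⟩ := exists_isComponent_of_nonneg (negPart_nonneg d)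
  have h3 := h2 _ (posPart_inf_negPart_eq_zero d)
  refine ⟨e, he, ?_, ?_⟩
  · rw [← posPart_sub_negPart d, mul_sub, h1, sub_zero]
    exact mul_nonneg he.nonneg (posPart_nonneg d)
  · rw [← posPart_sub_negPart d, mul_sub, h3, zero_sub, neg_nonpos]
    exact mul_nonneg he.one_sub_nonneg (negPart_nonneg d)

theorem IsComponent.abs_mul_le {e : E} (h : IsComponent e) (x : E) : |e * x| ≤ e * |x| := by
  refine abs_le'.2 ⟨mul_le_mul_of_nonneg_left (le_abs_self x) h.nonneg, ?_⟩
  rw [← mul_neg]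
  exact mul_le_mul_of_nonneg_left (neg_le_abs x) h.nonneg

theorem IsComponent.isBandProjection {e : E} (h : IsComponent e) :
    IsBandProjection (LinearMap.mulLeft ℝ e) := by
  have h0 : (1 - e) * e = 0 := by rw [sub_mul, one_mul, h.mul_self, sub_self]
  have hmem : ∀ x, x ∈ LinearMap.range (LinearMap.mulLeft ℝ e) ↔ (1 - e) * x = 0 := by
    intro x
    constructor
    · rintro ⟨y, rfl⟩
      rw [LinearMap.mulLeft_apply, ← mul_assoc, h0, zero_mul]
    · intro hx
      rw [sub_mul, one_mul, sub_eq_zero] at hx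
      exact ⟨x, hx.symm⟩
  have habs : ∀ x, (1 - e) * x = 0 → (1 - e) * |x| = 0 := by
    intro x hx
    have h1 : |x| ≤ e * |x| := by
      rw [sub_mul, one_mul, sub_eq_zero] at hx
      conv_lhs => rw [hx]
      exact h.abs_mul_le x
    refine le_antisymm ?_ (mul_nonneg h.one_sub_nonneg (abs_nonneg x))
    rw [sub_mul, one_mul]
    exact sub_nonpos.2 h1
  refine ⟨LinearMap.range (LinearMap.mulLeft ℝ e), ⟨?_, ?_⟩, fun x => ⟨⟨x, rfl⟩, ?_⟩⟩
  · intro x hx y hyx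
    rw [hmem] at hx ⊢
    have h1 : |(1 - e) * y| ≤ 0 := calc
      |(1 - e) * y| ≤ (1 - e) * |y| := h.one_sub.abs_mul_le y
      _ ≤ (1 - e) * |x| := mul_le_mul_of_nonneg_left hyx h.one_sub_nonneg
      _ = 0 := habs x hx
    exact le_antisymm ((le_abs_self _).trans h1) (neg_nonpos.1 ((neg_le_abs _).trans h1))
  · intro S hS s hs
    have hes : s ≤ e * s := by
      refine hs.2 fun t ht => ?_
      have h1 := (hmem t).1 (hS ht)
      rw [sub_mul, one_mul, sub_eq_zero] at h1
      rw [h1]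
      exact mul_le_mul_of_nonneg_left (hs.1 ht) h.nonneg
    rw [hmem]
    refine le_antisymm (by rw [sub_mul, one_mul]; exact sub_nonpos.2 hes) ?_
    -- The empty set has a supremum only if there is a least element, which must be `0`.
    rcases S.eq_empty_or_nonempty with rfl | ⟨t, ht⟩
    · have h1 : ∀ y, s ≤ y := fun y => hs.2 (by simp)
      have h2 : s = 0 := le_antisymm (h1 0) (by simpa using h1 (s + s))
      simp [h2]
    · rw [← (hmem t).1 (hS ht)]
      exact mul_le_mul_of_nonneg_left (hs.1 ht) h.one_sub_nonneg
  · intro y hy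
    rw [hmem] at hy
    have h1 := habs y hy
    have h2 : (1 - e) * |x| ⊓ e * |y| = 0 := by
      refine PhiAlgebra.mul_right_inf _ _ _ ?_ (abs_nonneg x)
      rw [inf_comm]
      exact PhiAlgebra.mul_right_inf _ _ _ h (abs_nonneg y)
    have h3 : |x - e * x| ≤ (1 - e) * |x| := by
      have := h.one_sub.abs_mul_le x
      rwa [sub_mul, one_mul] at this
    have h4 : |y| = e * |y| := by
      rwa [sub_mul, one_mul, sub_eq_zero] at h1
    rw [← h4] at h2
    exact inf_eq_zero_of_le (abs_nonneg _) h3 h2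

/-- Induction over unit slices of `x`. Where `N ≤ x ≤ N + 1`, subtracting the central element `N`
leaves the commutator unchanged and replaces `x` by something between `0` and `1`. The central
factor `e` is arbitrary because the induction localizes it further. -/
theorem mul_commutator_le_of_le_natCast {x y : E} (hx : 0 ≤ x) (hy : 0 ≤ y) (N : ℕ) :
    ∀ e : E, 0 ≤ e → (∀ z, Commute e z) → e * x ≤ e * N → e * (x * y - y * x) ≤ e * y := by
  induction N with
  | zero =>
    intro e he hc hex
    have h1 : e * x = 0 := le_antisymm (by simpa using hex) (mul_nonneg he hx)
    have h2 : e * (x * y - y * x) = 0 := by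
      rw [mul_sub, ← mul_assoc, h1, zero_mul, ← mul_assoc, (hc y).eq, mul_assoc, h1, mul_zero,
        sub_zero]
    rw [h2]
    exact mul_nonneg he hy
  | succ N ih =>
    intro e he hc hex
    obtain ⟨g, hg, hg1, hg2⟩ := exists_isComponent_split ((N : E) - x)
    have hcg : ∀ z, Commute g z := fun z => hg.commute z
    have hlow : (e * g) * (x * y - y * x) ≤ (e * g) * y := by
      refine ih _ (mul_nonneg he hg.nonneg) (fun z => (hc z).mul_left (hcg z)) ?_
      have h1 := mul_nonneg he hg1
      rwa [← mul_assoc, mul_sub, sub_nonneg] at h1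
    have hhigh : (e * (1 - g)) * (x * y - y * x) ≤ (e * (1 - g)) * y := by
      have hch : ∀ z, Commute (e * (1 - g)) z := fun z =>
        (hc z).mul_left ((Commute.one_left z).sub_left (hcg z))
      have h1 := mul_le_mul_of_nonneg_left hg2 he
      have h2 := mul_le_mul_of_nonneg_left hex hg.one_sub_nonneg
      have h3 : (1 - g) * e = e * (1 - g) := (hc _).eq.symm
      have hh : 0 ≤ e * (1 - g) := mul_nonneg he hg.one_sub_nonneg
      rw [← mul_assoc, mul_zero] at h1
      rw [← mul_assoc, ← mul_assoc, h3] at h2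
      set h := e * (1 - g) with hhdef
      clear_value h
      rw [mul_sub, sub_nonpos] at h1
      have h4 : h * (x * y - y * x) = (h * x - h * N) * y - y * (h * x - h * N) := by
        have h5 : y * (h * x) = h * (y * x) := by rw [← mul_assoc, ← (hch y).eq, mul_assoc]
        have h6 : y * (h * N) = h * N * y := by
          rw [← mul_assoc, ← (hch y).eq, mul_assoc, mul_assoc, (Nat.cast_commute N y).eq]
        rw [mul_sub, sub_mul, mul_sub, h5, h6, mul_assoc]
        abel
      rw [h4]
      have h7 : h * x - h * N ≤ h := by
        rw [Nat.cast_succ, mul_add, mul_one] at h2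
        exact sub_le_iff_le_add'.2 h2
      exact (sub_le_self _ (mul_nonneg hy (sub_nonneg.2 h1))).trans
        (mul_le_mul_of_nonneg_right h7 hy)
    have h3 := add_le_add hlow hhigh
    rwa [← add_mul, ← add_mul, ← mul_add, add_sub_cancel, mul_one] at h3

/-- Where `x ≤ N` the bounded case applies. On the complementary component `N ≤ x`, so there `N`
times the excess is at most `x * (x * y)`, uniformly in `N`; the Archimedean property concludes. -/
theorem commutator_le {x y : E} (hx : 0 ≤ x) (hy : 0 ≤ y) : x * y - y * x ≤ y := by
  rw [← sub_nonpos]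
  refine nonpos_of_forall_nsmul_le (v := x * (x * y)) fun N => ?_
  obtain ⟨e, he, h1, h2⟩ := exists_isComponent_split ((N : E) - x)
  have hxy := mul_nonneg hx hy
  have h3 : e * (x * y - y * x) ≤ e * y :=
    mul_commutator_le_of_le_natCast hx hy N e he.nonneg he.commute
      (by rwa [mul_sub, sub_nonneg] at h1)
  have h4 : (1 - e) * (x * y - y * x - y) ≤ (1 - e) * (x * y) := by
    refine mul_le_mul_of_nonneg_left ?_ he.one_sub_nonneg
    rw [sub_sub]
    exact sub_le_self _ (add_nonneg (mul_nonneg hy hx) hy)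
  have h5 : x * y - y * x - y ≤ (1 - e) * (x * y) := by
    have h6 : e * (x * y - y * x - y) ≤ 0 := by rwa [mul_sub, sub_nonpos]
    have h7 := add_le_add h6 h4
    rwa [← add_mul, add_sub_cancel, one_mul, zero_add] at h7
  calc N • (x * y - y * x - y) ≤ N • ((1 - e) * (x * y)) := nsmul_le_nsmul_right h5 N
    _ = ((1 - e) * N) * (x * y) := by
      rw [nsmul_eq_mul, ← mul_assoc, (Nat.cast_commute N (1 - e)).eq]
    _ ≤ ((1 - e) * x) * (x * y) := by
      refine mul_le_mul_of_nonneg_right ?_ hxy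
      rwa [mul_sub, sub_nonpos] at h2
    _ ≤ x * (x * y) := by
      refine mul_le_mul_of_nonneg_right ?_ hxy
      exact mul_le_of_le_one_left hx (sub_le_self _ he.nonneg)

theorem mul_le_mul_swap {x y : E} (hx : 0 ≤ x) (hy : 0 ≤ y) : x * y ≤ y * x := by
  rw [← sub_nonpos]
  refine nonpos_of_forall_nsmul_le (v := y) fun N => ?_
  -- The bound `y` does not depend on `x`, so replacing `x` by `N • x` scales the commutator alone.
  have h := commutator_le (nsmul_nonneg hx N) hy
  rwa [smul_mul_assoc, mul_smul_comm, ← smul_sub] at h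

/-- Archimedean unital `f`-algebras are commutative. -/
theorem phiAlgebra_mul_comm (x y : E) : x * y = y * x := by
  have key : ∀ u v : E, 0 ≤ u → 0 ≤ v → Commute u v := fun u v hu hv =>
    le_antisymm (mul_le_mul_swap hu hv) (mul_le_mul_swap hv hu)
  have key' : ∀ u : E, 0 ≤ u → Commute u y := fun u hu => by
    rw [← posPart_sub_negPart y]
    exact (key _ _ hu (posPart_nonneg y)).sub_right (key _ _ hu (negPart_nonneg y))
  change Commute x y
  rw [← posPart_sub_negPart x]
  exact (key' _ (posPart_nonneg x)).sub_left (key' _ (negPart_nonneg x))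

end Components

/-! ### Order continuity of multiplication. -/

section OrderContinuity

variable {E : Type u} [CommRing E] [ConditionallyCompleteLattice E] [Algebra ℝ E] [PhiAlgebra E]

theorem inf_mul_of_nonneg (x y : E) {z : E} (hz : 0 ≤ z) : (x ⊓ y) * z = (x * z) ⊓ (y * z) := by
  have h1 : (x - x ⊓ y) ⊓ (y - x ⊓ y) = 0 := by
    rw [← inf_sub, sub_self]
  have h2 : ((x - x ⊓ y) * z) ⊓ ((y - x ⊓ y) * z) = 0 := by
    refine PhiAlgebra.mul_right_inf _ _ z ?_ hz
    rw [inf_comm]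
    refine PhiAlgebra.mul_right_inf _ _ z ?_ hz
    rw [inf_comm, h1]
  rw [sub_mul, sub_mul, ← inf_sub, sub_eq_zero] at h2
  exact h2.symm

/-- Multiplication by a positive element is order continuous at `0`. -/
theorem isGLB_image_mul_right {S : Set E} (hS : IsGLB S 0) {M : E} (hM : 0 ≤ M) :
    IsGLB ((fun ε => ε * M) '' S) 0 := by
  refine ⟨?_, fun w hw => ?_⟩
  · rintro _ ⟨ε, hε, rfl⟩
    exact mul_nonneg (hS.1 hε) hM
  rcases S.eq_empty_or_nonempty with rfl | ⟨ε₀, hε₀⟩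
  · exact hS.2 (by simp)
  have h0 : 0 ≤ ε₀ := hS.1 hε₀
  refine nonpos_of_forall_nsmul_le (v := ε₀ * (M * M)) fun n => ?_
  rcases Nat.eq_zero_or_pos n with rfl | hn
  · rw [zero_smul]
    exact mul_nonneg h0 (mul_nonneg hM hM)
  have hn' : (0 : ℝ) < (n : ℝ) ^ 2 := by positivity
  have hbound : ∀ ε ∈ S, n • w - ε₀ * (M * M) ≤ ((n : ℝ) ^ 2) • ε := by
    intro ε hε
    have hm : 0 ≤ ε ⊓ ε₀ := le_inf (hS.1 hε) h0
    have h1 : w ≤ (ε ⊓ ε₀) * M := by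
      rw [inf_mul_of_nonneg _ _ hM]
      exact le_inf (hw ⟨ε, hε, rfl⟩) (hw ⟨ε₀, hε₀, rfl⟩)
    -- Expanding `(n - M)² ≥ 0` trades the unbounded factor `M` for a scalar: `n • w ≤ n² • ε + ε₀ *
    -- M²`. The infimum over `ε` removes the first term, and the second is independent of `n`.
    have h2 : (n : E) * M ≤ n * n + M * M := by
      have h3 := mul_self_nonneg_of_phiAlgebra ((n : E) - M)
      have h4 : 0 ≤ (n : E) * M := mul_nonneg (Nat.cast_nonneg n) hM
      have h5 : (n : E) * n + M * M = ((n : E) - M) * (n - M) + n * M + n * M := by ring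
      rw [h5, add_assoc]
      exact le_add_of_nonneg_of_le h3 (le_add_of_nonneg_left h4)
    have h6 : ((n : ℝ) ^ 2) • ε = ε * (n * n) := by
      rw [Algebra.smul_def, map_pow, map_natCast]
      ring
    rw [h6, sub_le_iff_le_add]
    calc n • w ≤ n • ((ε ⊓ ε₀) * M) := nsmul_le_nsmul_right h1 n
      _ = (ε ⊓ ε₀) * (n * M) := by rw [nsmul_eq_mul]; ring
      _ ≤ (ε ⊓ ε₀) * (n * n + M * M) := mul_le_mul_of_nonneg_left h2 hm
      _ = (ε ⊓ ε₀) * (n * n) + (ε ⊓ ε₀) * (M * M) := mul_add _ _ _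
      _ ≤ ε * (n * n) + ε₀ * (M * M) := add_le_add
        (mul_le_mul_of_nonneg_right inf_le_left (mul_nonneg (Nat.cast_nonneg n) (Nat.cast_nonneg n)))
        (mul_le_mul_of_nonneg_right inf_le_right (mul_nonneg hM hM))
  have h7 : (((n : ℝ) ^ 2)⁻¹) • (n • w - ε₀ * (M * M)) ≤ 0 := hS.2 fun ε hε =>
    (inv_smul_le_iff_of_pos hn').2 (hbound ε hε)
  rw [inv_smul_le_iff_of_pos hn', smul_zero, sub_nonpos] at h7
  exact h7

end OrderContinuity

/-! ### Partition sums as inductively built sums along chains. -/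

section ChainSums

variable {E : Type u} [AddCommGroup E] [Preorder E]

/-- `ChainSum g u v s`: `s` is the sum of the values of `g` at the consecutive pairs of a finite
chain from `u` to `v`. -/
inductive ChainSum (g : E → E → E) (u : E) : E → E → Prop
  | refl : ChainSum g u u 0
  | snoc {v w s : E} : ChainSum g u v s → v ≤ w → ChainSum g u w (s + g v w)

variable {g : E → E → E}

theorem ChainSum.le {u v s : E} (h : ChainSum g u v s) : u ≤ v := by
  induction h with
  | refl => exact le_rfl
  | snoc _ hvw ih => exact ih.trans hvw

theorem ChainSum.trans {u v w s t : E} (h : ChainSum g u v s) (h' : ChainSum g v w t) :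
    ChainSum g u w (s + t) := by
  induction h' with
  | refl => simpa using h
  | snoc _ hvw ih =>
    rw [← add_assoc]
    exact ih.snoc hvw

theorem chainSum_of_monotone (g : E → E → E) : ∀ (n : ℕ) (pt : Fin (n + 1) → E), Monotone pt →
    ChainSum g (pt 0) (pt (Fin.last n)) (∑ i : Fin n, g (pt i.castSucc) (pt i.succ)) := by
  intro n
  induction n with
  | zero =>
    intro pt _
    simpa using ChainSum.refl
  | succ n ih =>
    intro pt hpt
    rw [Fin.sum_univ_castSucc]
    exact (ih (fun i => pt i.castSucc) fun i j hij =>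
      hpt (Fin.castSucc_le_castSucc_iff.2 hij)).snoc (hpt (Fin.le_last _))

theorem ChainSum.exists_partition {u v s : E} (h : ChainSum g u v s) :
    ∃ P : IntervalPartition u v, ∑ i : Fin P.n, g (P.pt i.castSucc) (P.pt i.succ) = s := by
  induction h with
  | refl => exact ⟨⟨0, fun _ => u, fun _ _ _ => le_rfl, rfl, rfl⟩, by simp⟩
  | @snoc v w s _ hvw ih =>
    obtain ⟨P, hP⟩ := ih
    refine ⟨⟨P.n + 1, Fin.snoc (α := fun _ => E) P.pt w, ?_, ?_, ?_⟩, ?_⟩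
    · rw [Fin.monotone_iff_le_succ]
      intro i
      refine Fin.lastCases ?_ (fun j => ?_) i
      · rw [Fin.snoc_castSucc, Fin.succ_last, Fin.snoc_last, P.last]
        exact hvw
      · rw [Fin.snoc_castSucc, Fin.succ_castSucc, Fin.snoc_castSucc]
        exact P.mono (Fin.castSucc_lt_succ).le
    · rw [← Fin.castSucc_zero, Fin.snoc_castSucc, P.first]
    · rw [Fin.snoc_last]
    · rw [Fin.sum_univ_castSucc]
      simp only [Fin.succ_castSucc, Fin.snoc_castSucc, Fin.succ_last, Fin.snoc_last, P.last]
      rw [hP]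

theorem range_partition_sum (g : E → E → E) (u v : E) :
    (Set.range fun P : IntervalPartition u v =>
      ∑ i : Fin P.n, g (P.pt i.castSucc) (P.pt i.succ)) = {s | ChainSum g u v s} := by
  ext s
  constructor
  · rintro ⟨P, rfl⟩
    have h := chainSum_of_monotone g P.n P.pt P.mono
    rwa [P.first, P.last] at h
  · intro h
    obtain ⟨P, hP⟩ := ChainSum.exists_partition h
    exact ⟨P, hP⟩

end ChainSums

/-! ### Cutting, additivity and estimates for the upper integral. -/

section UpperIntegral

variable {E : Type u} [CommRing E] [ConditionallyCompleteLattice E] [Algebra ℝ E] [PhiAlgebra E]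
variable {f : E → E} {a b : E}

/-- `f` is order bounded on `[a, b]` and its localization at each component `e` of the unit is a
function of the localization of the argument. -/
structure BoundedLocalOn (f : E → E) (a b : E) : Prop where
  bddBelow : BddBelow (f '' Set.Icc a b)
  bddAbove : BddAbove (f '' Set.Icc a b)
  isLocal : ∀ e : E, IsComponent e → ∀ x ∈ Set.Icc a b, ∀ y ∈ Set.Icc a b,
    e * x = e * y → e * f x = e * f y

/-- The contribution of `[p, q]` to an upper sum of `f`. -/
noncomputable def upperTerm (f : E → E) (p q : E) : E := sSup (f '' Set.Icc p q) * (q - p)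

theorem upperIntegral_eq (f : E → E) (u v : E) :
    upperIntegral f u v = sInf {s | ChainSum (upperTerm f) u v s} := by
  rw [← range_partition_sum]
  rfl

namespace BoundedLocalOn

theorem neg (hf : BoundedLocalOn f a b) : BoundedLocalOn (-f) a b where
  bddBelow := by
    obtain ⟨M, hM⟩ := hf.bddAbove
    refine ⟨-M, ?_⟩
    rintro _ ⟨x, hx, rfl⟩
    exact neg_le_neg (hM ⟨x, hx, rfl⟩)
  bddAbove := by
    obtain ⟨M, hM⟩ := hf.bddBelow
    refine ⟨-M, ?_⟩
    rintro _ ⟨x, hx, rfl⟩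
    exact neg_le_neg (hM ⟨x, hx, rfl⟩)
  isLocal e he x hx y hy h := by
    simp only [Pi.neg_apply, mul_neg, hf.isLocal e he x hx y hy h]

theorem le_sSup (hf : BoundedLocalOn f a b) {u v z : E} (hu : a ≤ u) (hv : v ≤ b)
    (hz : z ∈ Set.Icc u v) : f z ≤ sSup (f '' Set.Icc u v) :=
  le_csSup (hf.bddAbove.mono (Set.image_mono (Set.Icc_subset_Icc hu hv))) ⟨z, hz, rfl⟩

theorem mul_sSup_le (hf : BoundedLocalOn f a b) {e u v p q : E} (he : IsComponent e)
    (hu : a ≤ u) (huv : u ≤ v) (hv : v ≤ b) (hp : a ≤ p) (hpq : p ≤ q) (hq : q ≤ b)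
    (hl : e * p ≤ e * u) (hr : e * v ≤ e * q) :
    e * sSup (f '' Set.Icc u v) ≤ e * sSup (f '' Set.Icc p q) := by
  have hee := he.mul_self
  have h1 : sSup (f '' Set.Icc u v) ≤
      e * sSup (f '' Set.Icc p q) + (1 - e) * sSup (f '' Set.Icc u v) := by
    refine csSup_le ((Set.nonempty_Icc.2 huv).image f) ?_
    rintro _ ⟨z, hz, rfl⟩
    -- Keeping `z` on `e` and using `p` elsewhere gives a point of `[p, q]` at which `f` agrees with
    -- `f z` on `e`.
    have hz' : e * z + (1 - e) * p ∈ Set.Icc p q := by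
      constructor
      · calc p = e * p + (1 - e) * p := by ring
          _ ≤ e * z + (1 - e) * p := by
            refine add_le_add ?_ le_rfl
            exact hl.trans (mul_le_mul_of_nonneg_left hz.1 he.nonneg)
      · calc e * z + (1 - e) * p ≤ e * q + (1 - e) * q := by
              refine add_le_add ?_ (mul_le_mul_of_nonneg_left hpq he.one_sub_nonneg)
              exact (mul_le_mul_of_nonneg_left hz.2 he.nonneg).trans hr
          _ = q := by ring
    have hez : e * z = e * (e * z + (1 - e) * p) := by
      linear_combination (p - z) * hee
    have hfz := hf.isLocal e he z ⟨hu.trans hz.1, hz.2.trans hv⟩ _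
      ⟨hp.trans hz'.1, hz'.2.trans hq⟩ hez
    calc f z = e * f z + (1 - e) * f z := by ring
      _ ≤ _ := by
        rw [hfz]
        exact add_le_add (mul_le_mul_of_nonneg_left (hf.le_sSup hp hq hz') he.nonneg)
          (mul_le_mul_of_nonneg_left (hf.le_sSup hu hv hz) he.one_sub_nonneg)
  have h2 := mul_le_mul_of_nonneg_left h1 he.nonneg
  have h3 : e * (e * sSup (f '' Set.Icc p q) + (1 - e) * sSup (f '' Set.Icc u v)) =
      e * sSup (f '' Set.Icc p q) := by
    linear_combination (sSup (f '' Set.Icc p q) - sSup (f '' Set.Icc u v)) * hee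
  rwa [h3] at h2

theorem upperTerm_le (hf : BoundedLocalOn f a b) {e u v p q : E} (he : IsComponent e)
    (hu : a ≤ u) (huv : u ≤ v) (hv : v ≤ b) (hp : a ≤ p) (hpq : p ≤ q) (hq : q ≤ b)
    (hl : e * p ≤ e * u) (hr : e * v ≤ e * q) (hw : (1 - e) * (v - u) ≤ 0) :
    upperTerm f u v ≤ sSup (f '' Set.Icc p q) * (v - u) := by
  have hvu : 0 ≤ v - u := sub_nonneg.2 huv
  have h0 : (1 - e) * (v - u) = 0 := le_antisymm hw (mul_nonneg he.one_sub_nonneg hvu)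
  calc upperTerm f u v = (e * sSup (f '' Set.Icc u v)) * (v - u) := by
        rw [upperTerm]
        linear_combination sSup (f '' Set.Icc u v) * h0
    _ ≤ (e * sSup (f '' Set.Icc p q)) * (v - u) :=
        mul_le_mul_of_nonneg_right (hf.mul_sSup_le he hu huv hv hp hpq hq hl hr) hvu
    _ = sSup (f '' Set.Icc p q) * (v - u) := by
        linear_combination -sSup (f '' Set.Icc p q) * h0

theorem upperTerm_split (hf : BoundedLocalOn f a b) {p q c : E} (hp : a ≤ p) (hpq : p ≤ q)
    (hq : q ≤ b) (hc : c ∈ Set.Icc a b) :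
    upperTerm f (p ⊓ c) (q ⊓ c) + upperTerm f (p ⊔ c) (q ⊔ c) ≤ upperTerm f p q := by
  have hm {e x y : E} (he : IsComponent e) (h : x ≤ y) : e * x ≤ e * y :=
    mul_le_mul_of_nonneg_left h he.nonneg
  have h1 : upperTerm f (p ⊓ c) (q ⊓ c) ≤ sSup (f '' Set.Icc p q) * (q ⊓ c - p ⊓ c) := by
    -- On `e`, `p ≤ c` and the piece lies in `[p, q]`; off `e`, `c ≤ p ≤ q` and both endpoints are
    -- `c`.
    obtain ⟨e, he, h1, h2⟩ := exists_isComponent_split (c - p)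
    refine hf.upperTerm_le he (le_inf hp hc.1) (inf_le_inf_right c hpq) (inf_le_right.trans hc.2)
      hp hpq hq ?_ (hm he inf_le_left) ?_
    · rw [mul_comm e (p ⊓ c), inf_mul_of_nonneg _ _ he.nonneg]
      refine le_inf (mul_comm e p).le ?_
      rwa [mul_sub, sub_nonneg, mul_comm e c] at h1
    · have h3 : (1 - e) * (q ⊓ c) ≤ (1 - e) * (p ⊓ c) := by
        rw [mul_comm _ (p ⊓ c), inf_mul_of_nonneg _ _ he.one_sub_nonneg]
        rw [mul_sub, sub_nonpos] at h2
        refine (hm he.one_sub inf_le_right).trans (le_inf ?_ (mul_comm _ _).le)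
        rwa [mul_comm p]
      rw [mul_sub, sub_nonpos]
      exact h3
  have h2 : upperTerm f (p ⊔ c) (q ⊔ c) ≤ sSup (f '' Set.Icc p q) * (q ⊔ c - p ⊔ c) := by
    have hsup : ∀ e : E, IsComponent e → ∀ z : E, e * c ≤ e * z → e * (z ⊔ c) ≤ e * z := by
      intro e he z hz
      have h3 : e * (z ⊔ c) = e * z + e * c - e * (z ⊓ c) := by
        linear_combination e * inf_add_sup z c
      rw [h3, mul_comm e (z ⊓ c), inf_mul_of_nonneg _ _ he.nonneg, mul_comm z, mul_comm c,
        inf_eq_right.2 hz, add_sub_cancel_right]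
    -- Dually, on `e`, `c ≤ q` and the piece lies in `[p, q]`; off `e`, `p ≤ q ≤ c` and it collapses
    -- to `c`.
    obtain ⟨e, he, h1, h2⟩ := exists_isComponent_split (q - c)
    refine hf.upperTerm_le he (hp.trans le_sup_left) (sup_le_sup_right hpq c) (sup_le hq hc.2)
      hp hpq hq (hm he le_sup_left) ?_ ?_
    · rw [mul_sub, sub_nonneg] at h1
      exact hsup e he q h1
    · rw [mul_sub, sub_nonpos] at h2 ⊢
      have h4 : (1 - e) * (q ⊔ c) ≤ (1 - e) * c := by
        have h3 : (1 - e) * (q ⊔ c) = (1 - e) * q + (1 - e) * c - (1 - e) * (q ⊓ c) := by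
          linear_combination (1 - e) * inf_add_sup q c
        rw [h3, mul_comm _ (q ⊓ c), inf_mul_of_nonneg _ _ he.one_sub_nonneg, mul_comm q, mul_comm c,
          inf_eq_left.2 h2, add_sub_cancel_left]
      exact h4.trans (hm he.one_sub le_sup_right)
  refine (add_le_add h1 h2).trans (le_of_eq ?_)
  rw [upperTerm]
  linear_combination sSup (f '' Set.Icc p q) * (inf_add_sup q c - inf_add_sup p c)

theorem mul_sub_le_of_chainSum (hf : BoundedLocalOn f a b) {u v s k : E} (hu : a ≤ u)
    (hs : ChainSum (upperTerm f) u v s) :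
    v ≤ b → (∀ z ∈ Set.Icc u v, k ≤ f z) → k * (v - u) ≤ s := by
  induction hs with
  | refl => simp
  | @snoc v w s hs hvw ih =>
    intro hw hk
    have huv := hs.le
    have h1 := ih (hvw.trans hw) fun z hz => hk z ⟨hz.1, hz.2.trans hvw⟩
    have h2 : k ≤ sSup (f '' Set.Icc v w) :=
      (hk v ⟨huv, hvw⟩).trans (hf.le_sSup (hu.trans huv) hw ⟨le_rfl, hvw⟩)
    calc k * (w - u) = k * (v - u) + k * (w - v) := by ring
      _ ≤ s + upperTerm f v w :=
        add_le_add h1 (mul_le_mul_of_nonneg_right h2 (sub_nonneg.2 hvw))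

theorem bddBelow_chainSum (hf : BoundedLocalOn f a b) {u v : E} (hu : a ≤ u) (hv : v ≤ b) :
    BddBelow {s | ChainSum (upperTerm f) u v s} := by
  obtain ⟨m, hm⟩ := hf.bddBelow
  exact ⟨m * (v - u), fun s hs => hf.mul_sub_le_of_chainSum hu hs hv fun z hz =>
    hm ⟨z, ⟨hu.trans hz.1, hz.2.trans hv⟩, rfl⟩⟩

theorem chainSum_single {g : E → E → E} {u v : E} (huv : u ≤ v) : ChainSum g u v (g u v) := by
  simpa using ChainSum.refl.snoc huv

theorem upperIntegral_le (hf : BoundedLocalOn f a b) {u v s : E} (hu : a ≤ u) (hv : v ≤ b)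
    (hs : ChainSum (upperTerm f) u v s) : upperIntegral f u v ≤ s := by
  rw [upperIntegral_eq]
  exact csInf_le (hf.bddBelow_chainSum hu hv) hs

theorem le_upperIntegral {u v t : E} (huv : u ≤ v)
    (h : ∀ s, ChainSum (upperTerm f) u v s → t ≤ s) : t ≤ upperIntegral f u v := by
  rw [upperIntegral_eq]
  exact le_csInf ⟨_, chainSum_single huv⟩ h

theorem mul_sub_le_upperIntegral (hf : BoundedLocalOn f a b) {u v k : E} (hu : a ≤ u)
    (huv : u ≤ v) (hv : v ≤ b) (hk : ∀ z ∈ Set.Icc u v, k ≤ f z) :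
    k * (v - u) ≤ upperIntegral f u v :=
  le_upperIntegral huv fun _ hs => hf.mul_sub_le_of_chainSum hu hs hv hk

theorem upperIntegral_le_mul_sub (hf : BoundedLocalOn f a b) {u v k : E} (hu : a ≤ u)
    (huv : u ≤ v) (hv : v ≤ b) (hk : ∀ z ∈ Set.Icc u v, f z ≤ k) :
    upperIntegral f u v ≤ k * (v - u) := by
  refine (hf.upperIntegral_le hu hv (chainSum_single huv)).trans
    (mul_le_mul_of_nonneg_right ?_ (sub_nonneg.2 huv))
  refine csSup_le ((Set.nonempty_Icc.2 huv).image f) ?_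
  rintro _ ⟨z, hz, rfl⟩
  exact hk z hz

theorem upperIntegral_self (hf : BoundedLocalOn f a b) {u : E} (hu : u ∈ Set.Icc a b) :
    upperIntegral f u u = 0 := by
  have hk : ∀ z ∈ Set.Icc u u, z = u := fun z hz => le_antisymm hz.2 hz.1
  refine le_antisymm ?_ ?_
  · simpa using hf.upperIntegral_le_mul_sub (k := f u) hu.1 le_rfl hu.2
      fun z hz => by rw [hk z hz]
  · simpa using hf.mul_sub_le_upperIntegral (k := f u) hu.1 le_rfl hu.2
      fun z hz => by rw [hk z hz]

theorem upperIntegral_le_add (hf : BoundedLocalOn f a b) {u v w : E} (hu : a ≤ u) (huv : u ≤ v)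
    (hvw : v ≤ w) (hw : w ≤ b) :
    upperIntegral f u w ≤ upperIntegral f u v + upperIntegral f v w := by
  rw [← sub_le_iff_le_add']
  refine le_upperIntegral hvw fun t ht => ?_
  rw [sub_le_comm]
  refine le_upperIntegral huv fun s hs => ?_
  rw [sub_le_iff_le_add]
  exact hf.upperIntegral_le hu hw (hs.trans ht)

theorem exists_chainSum_split (hf : BoundedLocalOn f a b) {u v s c : E} (hu : a ≤ u)
    (hc : c ∈ Set.Icc a b) (hs : ChainSum (upperTerm f) u v s) :
    v ≤ b → ∃ s₁ s₂, ChainSum (upperTerm f) (u ⊓ c) (v ⊓ c) s₁ ∧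
      ChainSum (upperTerm f) (u ⊔ c) (v ⊔ c) s₂ ∧ s₁ + s₂ ≤ s := by
  induction hs with
  | refl => exact fun _ => ⟨0, 0, .refl, .refl, by simp⟩
  | @snoc v w s hs hvw ih =>
    intro hw
    obtain ⟨s₁, s₂, h1, h2, h3⟩ := ih (hvw.trans hw)
    refine ⟨_, _, h1.snoc (inf_le_inf_right c hvw), h2.snoc (sup_le_sup_right hvw c), ?_⟩
    rw [add_add_add_comm]
    exact add_le_add h3 (hf.upperTerm_split (hu.trans hs.le) hvw hw hc)

theorem upperIntegral_inf_add_sup_le (hf : BoundedLocalOn f a b) {u v c : E} (hu : a ≤ u)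
    (huv : u ≤ v) (hv : v ≤ b) (hc : c ∈ Set.Icc a b) :
    upperIntegral f (u ⊓ c) (v ⊓ c) + upperIntegral f (u ⊔ c) (v ⊔ c) ≤ upperIntegral f u v := by
  refine le_upperIntegral huv fun s hs => ?_
  obtain ⟨s₁, s₂, h1, h2, h3⟩ := hf.exists_chainSum_split hu hc hs hv
  exact (add_le_add (hf.upperIntegral_le (le_inf hu hc.1) (inf_le_right.trans hc.2) h1)
    (hf.upperIntegral_le (hu.trans le_sup_left) (sup_le hv hc.2) h2)).trans h3

theorem upperIntegral_add (hf : BoundedLocalOn f a b) {u v w : E} (hu : a ≤ u) (huv : u ≤ v)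
    (hvw : v ≤ w) (hw : w ≤ b) :
    upperIntegral f u v + upperIntegral f v w = upperIntegral f u w := by
  refine le_antisymm ?_ (hf.upperIntegral_le_add hu huv hvw hw)
  have h := hf.upperIntegral_inf_add_sup_le hu (huv.trans hvw) hw
    ⟨hu.trans huv, hvw.trans hw⟩
  rwa [inf_eq_left.2 huv, inf_eq_right.2 hvw, sup_eq_right.2 huv, sup_eq_left.2 hvw] at h

/-- Cutting `[c, x ⊔ c]` at `x` leaves `[x ⊓ c, x]` and a degenerate interval, while cutting `[x ⊓
c, x]` at `c` leaves `[c, x ⊔ c]` and a degenerate interval. Each cut gives one inequality. -/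
theorem upperIntegral_inf_left (hf : BoundedLocalOn f a b) {x c : E} (hx : x ∈ Set.Icc a b)
    (hc : c ∈ Set.Icc a b) : upperIntegral f (x ⊓ c) x = upperIntegral f c (x ⊔ c) := by
  refine le_antisymm ?_ ?_
  · have h := hf.upperIntegral_inf_add_sup_le hc.1 le_sup_right (sup_le hx.2 hc.2) hx
    rwa [inf_eq_right.2 (le_sup_left : x ≤ x ⊔ c), sup_eq_left.2 (le_sup_left : x ≤ x ⊔ c),
      sup_comm c x, hf.upperIntegral_self ⟨hx.1.trans le_sup_left, sup_le hx.2 hc.2⟩, add_zero,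
      inf_comm] at h
  · have h := hf.upperIntegral_inf_add_sup_le (le_inf hx.1 hc.1) inf_le_left hx.2 hc
    rwa [inf_eq_left.2 (inf_le_right : x ⊓ c ≤ c), sup_eq_right.2 (inf_le_right : x ⊓ c ≤ c),
      hf.upperIntegral_self ⟨le_inf hx.1 hc.1, inf_le_left.trans hx.2⟩, zero_add] at h

theorem lowerIntegral_eq_neg (hf : BoundedLocalOn f a b) {u v : E} (hu : a ≤ u) (huv : u ≤ v)
    (hv : v ≤ b) : lowerIntegral f u v = -upperIntegral (-f) u v := by
  have hterm : ∀ p q, a ≤ p → p ≤ q → q ≤ b →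
      sInf (f '' Set.Icc p q) = -sSup ((-f) '' Set.Icc p q) := by
    intro p q hp hpq hq
    have h1 : (-f) '' Set.Icc p q = -(f '' Set.Icc p q) := by
      rw [← Set.image_neg_eq_neg, Set.image_image]
      rfl
    rw [h1, csSup_neg ((Set.nonempty_Icc.2 hpq).image f)
      (hf.bddBelow.mono (Set.image_mono (Set.Icc_subset_Icc hp hq))), neg_neg]
  have hsum : ∀ P : IntervalPartition u v, lowerSum f P = -upperSum (-f) P := by
    intro P
    rw [lowerSum, upperSum, ← Finset.sum_neg_distrib]
    refine Finset.sum_congr rfl fun i _ => ?_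
    rw [hterm _ _ ?_ (P.mono Fin.castSucc_lt_succ.le) ?_, neg_mul]
    · exact hu.trans (P.first.ge.trans (P.mono (Fin.zero_le _)))
    · exact ((P.mono (Fin.le_last _)).trans P.last.le).trans hv
  have hrange : (Set.range fun P : IntervalPartition u v => lowerSum f P) =
      -Set.range fun P : IntervalPartition u v => upperSum (-f) P := by
    rw [← Set.image_neg_eq_neg, ← Set.range_comp]
    exact congrArg Set.range (funext hsum)
  have hset : (Set.range fun P : IntervalPartition u v => upperSum (-f) P) =
      {s | ChainSum (upperTerm (-f)) u v s} := range_partition_sum (upperTerm (-f)) u v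
  rw [lowerIntegral, upperIntegral, hrange, hset]
  exact csSup_neg ⟨_, chainSum_single huv⟩ (hf.neg.bddBelow_chainSum hu hv)

/-- Two chains in a partial order need not have a common refinement. A lower sum is instead compared
link by link with the upper integral, which is already additive. -/
theorem neg_chainSum_le_upperIntegral (hf : BoundedLocalOn f a b) {u v s : E} (hu : a ≤ u)
    (hs : ChainSum (upperTerm (-f)) u v s) : v ≤ b → -s ≤ upperIntegral f u v := by
  induction hs with
  | refl => exact fun hv => by simp [hf.upperIntegral_self ⟨hu, hv⟩]
  | @snoc v w s hs hvw ih =>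
    intro hw
    rw [neg_add, ← hf.upperIntegral_add hu hs.le hvw hw]
    refine add_le_add (ih (hvw.trans hw)) ?_
    have hv := hu.trans hs.le
    rw [upperTerm, ← neg_mul]
    refine hf.mul_sub_le_upperIntegral hv hvw hw fun z hz => ?_
    exact neg_le.1 (hf.neg.le_sSup hv hw hz)

theorem lowerIntegral_le_upperIntegral (hf : BoundedLocalOn f a b) {u v : E} (hu : a ≤ u)
    (huv : u ≤ v) (hv : v ≤ b) : lowerIntegral f u v ≤ upperIntegral f u v := by
  rw [hf.lowerIntegral_eq_neg hu huv hv, neg_le]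
  exact le_upperIntegral huv fun s hs => neg_le.1 (hf.neg_chainSum_le_upperIntegral hu hs hv)

theorem integrableOn_left (hf : BoundedLocalOn f a b)
    (h : upperIntegral f a b = lowerIntegral f a b) {x : E} (hx : x ∈ Set.Icc a b) :
    IntegrableOn f a x := by
  have hsub : f '' Set.Icc a x ⊆ f '' Set.Icc a b :=
    Set.image_mono (Set.Icc_subset_Icc le_rfl hx.2)
  refine ⟨hf.bddBelow.mono hsub, hf.bddAbove.mono hsub, ?_⟩
  have hab := hx.1.trans hx.2
  have h1 := hf.lowerIntegral_le_upperIntegral le_rfl hx.1 hx.2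
  have h2 := hf.lowerIntegral_le_upperIntegral hx.1 hx.2 le_rfl
  have h3 := hf.upperIntegral_add le_rfl hx.1 hx.2 le_rfl
  have h4 := hf.neg.upperIntegral_add le_rfl hx.1 hx.2 le_rfl
  rw [hf.lowerIntegral_eq_neg le_rfl hab le_rfl, ← h4, ← h3] at h
  refine le_antisymm ?_ h1
  rw [hf.lowerIntegral_eq_neg le_rfl hx.1 hx.2] at h1 ⊢
  rw [hf.lowerIntegral_eq_neg hx.1 hx.2 le_rfl] at h2
  -- The gap on `[a, x]` is minus the gap on `[x, b]`, hence nonpositive.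
  calc upperIntegral f a x
      = -upperIntegral (-f) a x + (-upperIntegral (-f) x b - upperIntegral f x b) := by
        linear_combination h
    _ ≤ -upperIntegral (-f) a x := add_le_of_nonpos_right (sub_nonpos.2 h2)

/-- The increment of the integral differs from a linear function by at most the oscillation. -/
theorem abs_upperIntegral_sub_le (hf : BoundedLocalOn f a b) {x c k ε : E}
    (hx : x ∈ Set.Icc a b) (hc : c ∈ Set.Icc a b)
    (hk : ∀ z ∈ Set.Icc (x ⊓ c) (x ⊔ c), |f z - k| ≤ ε) :
    |upperIntegral f a x - upperIntegral f a c - (x - c) * k| ≤ |x - c| * ε := by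
  have hinf : a ≤ x ⊓ c := le_inf hx.1 hc.1
  have hsup : x ⊔ c ≤ b := sup_le hx.2 hc.2
  have hl : ∀ z ∈ Set.Icc (x ⊓ c) (x ⊔ c), k - ε ≤ f z := fun z hz => by
    have := (neg_le_abs _).trans (hk z hz)
    rwa [neg_sub, sub_le_comm] at this
  have hr : ∀ z ∈ Set.Icc (x ⊓ c) (x ⊔ c), f z ≤ k + ε := fun z hz =>
    sub_le_iff_le_add'.1 ((le_abs_self _).trans (hk z hz))
  have e1 := hf.upperIntegral_add le_rfl hinf (inf_le_left : x ⊓ c ≤ x) hx.2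
  have e2 := hf.upperIntegral_add le_rfl hinf (inf_le_right : x ⊓ c ≤ c) hc.2
  have e3 := hf.upperIntegral_inf_left hx hc
  have hsubr : ∀ z ∈ Set.Icc c (x ⊔ c), z ∈ Set.Icc (x ⊓ c) (x ⊔ c) := fun z hz =>
    ⟨inf_le_right.trans hz.1, hz.2⟩
  have hsubl : ∀ z ∈ Set.Icc (x ⊓ c) c, z ∈ Set.Icc (x ⊓ c) (x ⊔ c) := fun z hz =>
    ⟨hz.1, hz.2.trans le_sup_right⟩
  have r1 := hf.upperIntegral_le_mul_sub hc.1 le_sup_right hsup fun z hz => hr z (hsubr z hz)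
  have r2 := hf.mul_sub_le_upperIntegral hc.1 le_sup_right hsup fun z hz => hl z (hsubr z hz)
  have l1 := hf.upperIntegral_le_mul_sub hinf inf_le_right hc.2 fun z hz => hr z (hsubl z hz)
  have l2 := hf.mul_sub_le_upperIntegral hinf inf_le_right hc.2 fun z hz => hl z (hsubl z hz)
  have habs : |x - c| = (x ⊔ c - c) + (c - x ⊓ c) := by
    rw [sub_add_sub_cancel, sup_sub_inf_eq_abs_sub, abs_sub_comm]
  have hxc : x - c = (x ⊔ c - c) - (c - x ⊓ c) := by
    linear_combination -inf_add_sup x c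
  rw [habs, abs_le', hxc]
  constructor
  · rw [← sub_nonneg] at r1 l2 ⊢
    refine (add_nonneg r1 l2).trans_eq ?_
    linear_combination -e1 + e2 + e3
  · rw [← sub_nonneg] at r2 l1 ⊢
    refine (add_nonneg r2 l1).trans_eq ?_
    linear_combination e1 - e2 - e3

end BoundedLocalOn

end UpperIntegral

/-! ### Order continuity by bounds, and the theorem itself. -/

section FundamentalTheorem

/-- Indices for the net of all points of `D` close to `c`, ordered by the bound in `Δ` on the
distance to `c`. -/
structure NearIndex {E : Type u} [AddCommGroup E] [Lattice E] (D Δ : Set E) (c : E) where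
  bound : E
  point : E
  bound_mem : bound ∈ Δ
  point_mem : point ∈ D
  dist_le : |point - c| ≤ bound

instance {E : Type u} [AddCommGroup E] [Lattice E] (D Δ : Set E) (c : E) :
    Preorder (NearIndex D Δ c) where
  le i j := j.bound ≤ i.bound
  le_refl _ := le_rfl
  le_trans _ _ _ h h' := le_trans h' h

theorem OrderContinuousOn.exists_bound {E : Type u} [AddCommGroup E] [Lattice E] {f : E → E}
    {D Δ : Set E} {c : E} (hf : OrderContinuousOn f D) (hc : c ∈ D) (hΔ : DecreasesToZero Δ) :
    ∃ S : Set E, IsGLB S 0 ∧ ∀ ε ∈ S, ∃ δ ∈ Δ, ∀ z ∈ D, |z - c| ≤ δ → |f z - f c| ≤ ε := by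
  have h0 : ∀ δ ∈ Δ, |c - c| ≤ δ := fun δ hδ => by simpa [abs] using hΔ.isGLB.1 hδ
  obtain ⟨δ₀, hδ₀⟩ := hΔ.nonempty
  have : Nonempty (NearIndex D Δ c) := ⟨⟨δ₀, c, hδ₀, hc, h0 _ hδ₀⟩⟩
  have : IsDirectedOrder (NearIndex D Δ c) := ⟨fun i j => by
    obtain ⟨δ, hδ, hi, hj⟩ := hΔ.directed _ i.bound_mem _ j.bound_mem
    exact ⟨⟨δ, c, hδ, hc, h0 _ hδ⟩, hi, hj⟩⟩
  obtain ⟨S, hS, h⟩ := hf c hc (NearIndex D Δ c) (fun i => i.point) (fun i => i.point_mem)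
    ⟨Δ, hΔ.isGLB, fun δ hδ => ⟨⟨δ, c, hδ, hc, h0 _ hδ⟩, fun i hi => i.dist_le.trans hi⟩⟩
  refine ⟨S, hS, fun ε hε => ?_⟩
  obtain ⟨i, hi⟩ := h ε hε
  -- The order on indices ignores the points, so every `z` within `i.bound` of `c` gives an index
  -- beyond `i`.
  exact ⟨i.bound, i.bound_mem, fun z hz hzc => hi ⟨i.bound, z, i.bound_mem, hz, hzc⟩ le_rfl⟩

theorem IsWeakOrderUnit.inf {E : Type u} [AddCommGroup E] [Lattice E] [IsOrderedAddMonoid E]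
    {r s : E} (hr : IsWeakOrderUnit r) (hs : IsWeakOrderUnit s) : IsWeakOrderUnit (r ⊓ s) := by
  have h0 : 0 ≤ r ⊓ s := le_inf hr.1 hs.1
  refine ⟨h0, fun x hx => hr.2 x ?_⟩
  have h1 : |x| ⊓ r = 0 := by
    refine hs.2 _ ?_
    have h2 : 0 ≤ |x| ⊓ r := le_inf (abs_nonneg x) hr.1
    rw [IsDisjoint, abs_of_nonneg h2, abs_of_nonneg hs.1, inf_assoc, ← abs_of_nonneg h0]
    exact hx
  rwa [IsDisjoint, abs_of_nonneg hr.1]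

variable {E : Type u} [CommRing E] [ConditionallyCompleteLattice E] [Algebra ℝ E] [PhiAlgebra E]
variable {f : E → E} {a b : E}

theorem BoundedLocalOn.of_locallyBandPreservingOn
    (hlbp : LocallyBandPreservingOn f (Set.Icc a b)) (hbelow : BddBelow (f '' Set.Icc a b))
    (habove : BddAbove (f '' Set.Icc a b)) : BoundedLocalOn f a b :=
  ⟨hbelow, habove, fun _ he x hx y hy h => hlbp _ he.isBandProjection x hx y hy h⟩

theorem BoundedLocalOn.uniformlyOrderContinuousOn (hf : BoundedLocalOn f a b) :
    UniformlyOrderContinuousOn (fun x => integral f a x) (Set.Icc a b) := by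
  intro ι _ _ _ x y hx hy ⟨S, hS, h⟩
  obtain ⟨m, hm⟩ := hf.bddBelow
  obtain ⟨M, hM⟩ := hf.bddAbove
  have hbound : ∀ z ∈ Set.Icc a b, |f z - 0| ≤ |m| ⊔ |M| := by
    intro z hz
    rw [sub_zero, abs_le']
    constructor
    · exact (hM ⟨z, hz, rfl⟩).trans ((le_abs_self M).trans le_sup_right)
    · exact (neg_le_neg (hm ⟨z, hz, rfl⟩)).trans ((neg_le_abs m).trans le_sup_left)
  have hK : 0 ≤ |m| ⊔ |M| := (abs_nonneg m).trans le_sup_left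
  refine ⟨_, isGLB_image_mul_right hS hK, ?_⟩
  rintro _ ⟨ε, hε, rfl⟩
  obtain ⟨i₀, hi₀⟩ := h ε hε
  refine ⟨i₀, fun i hi => ?_⟩
  have h1 := hf.abs_upperIntegral_sub_le (hx i) (hy i) (k := 0) fun z hz =>
    hbound z ⟨(le_inf (hx i).1 (hy i).1).trans hz.1, hz.2.trans (sup_le (hx i).2 (hy i).2)⟩
  rw [mul_zero] at h1
  have h2 := hi₀ i hi
  rw [sub_zero] at h2
  exact h1.trans (mul_le_mul_of_nonneg_right h2 hK)

theorem BoundedLocalOn.hasSuperOrderDerivAt (hf : BoundedLocalOn f a b)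
    (hcont : OrderContinuousOn f (Set.Icc a b)) {c : E} (hc : c ∈ openInterval a b) :
    HasSuperOrderDerivAt (fun x => integral f a x) (Set.Icc a b) (f c) c := by
  have hcm : c ∈ Set.Icc a b := ⟨sub_nonneg.1 hc.1.1, sub_nonneg.1 hc.2.1⟩
  refine ⟨hcm, (c - a) ⊓ (b - c), hc.1.inf hc.2, fun x hx => ⟨?_, ?_⟩, fun Δ hΔ => ?_⟩
  · refine le_trans ?_ (sub_nonneg.1 hx.1.1)
    rw [le_sub_comm]
    exact inf_le_left
  · refine (sub_nonneg.1 hx.2.1).trans ?_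
    rw [← le_sub_iff_add_le']
    exact inf_le_right
  · obtain ⟨S, hS, h⟩ := hcont.exists_bound hcm hΔ
    refine ⟨S, hS, fun ε hε => ?_⟩
    obtain ⟨δ, hδ, hbound⟩ := h ε hε
    refine ⟨δ, hδ, fun x hx hxc => ?_⟩
    -- Points between `x ⊓ c` and `x ⊔ c` are no farther from `c` than `x` is, so the same `δ`
    -- works.
    refine hf.abs_upperIntegral_sub_le hx hcm fun z hz => hbound z
      ⟨(le_inf hx.1 hcm.1).trans hz.1, hz.2.trans (sup_le hx.2 hcm.2)⟩ (le_trans ?_ hxc)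
    have hsup : x ⊔ c - c ≤ |x - c| := by
      rw [sup_sub, sub_self]
      exact sup_le (le_abs_self _) (abs_nonneg _)
    have hinf : c - x ⊓ c ≤ |x - c| := by
      rw [sub_inf, sub_self]
      refine sup_le ?_ (abs_nonneg _)
      rw [abs_sub_comm]
      exact le_abs_self _
    refine abs_le'.2 ⟨(sub_le_sub_right hz.2 c).trans hsup, ?_⟩
    rw [neg_sub]
    exact (sub_le_sub_left hz.1 c).trans hinf

theorem fundamentalTheorem_of_commRing
    (hcont : OrderContinuousOn f (Set.Icc a b))
    (hlbp : LocallyBandPreservingOn f (Set.Icc a b)) (hint : IntegrableOn f a b) :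
    (∀ x ∈ Set.Icc a b, IntegrableOn f a x) ∧
    UniformlyOrderContinuousOn (fun x => integral f a x) (Set.Icc a b) ∧
    ∀ c ∈ openInterval a b,
      HasSuperOrderDerivAt (fun x => integral f a x) (Set.Icc a b) (f c) c :=
  have hf := BoundedLocalOn.of_locallyBandPreservingOn hlbp hint.bddBelow hint.bddAbove
  ⟨fun _ hx => hf.integrableOn_left hint.upper_eq_lower hx, hf.uniformlyOrderContinuousOn,
    fun _ hc => hf.hasSuperOrderDerivAt hcont hc⟩

end FundamentalTheorem
end VectorLattice

theorem theoremt {E : Type u} [Ring E] [ConditionallyCompleteLattice E] [Algebra ℝ E]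
    [VectorLattice.PhiAlgebra E] (a b : E) (hab : VectorLattice.WeakUnitLT a b) (f : E → E)
    (hcont : VectorLattice.OrderContinuousOn f (Set.Icc a b))
    (hlbp : VectorLattice.LocallyBandPreservingOn f (Set.Icc a b))
    (hint : VectorLattice.IntegrableOn f a b) :
    (∀ x ∈ Set.Icc a b, VectorLattice.IntegrableOn f a x) ∧
    VectorLattice.UniformlyOrderContinuousOn
      (fun x => VectorLattice.integral f a x) (Set.Icc a b) ∧
    ∀ c ∈ VectorLattice.openInterval a b,
      VectorLattice.HasSuperOrderDerivAt
        (fun x => VectorLattice.integral f a x) (Set.Icc a b) (f c) c := by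
  -- The commutative structure extends the given ring, so both versions of the statement involve the
  -- same operations.
  let _ : CommRing E := { ‹Ring E› with mul_comm := VectorLattice.phiAlgebra_mul_comm }
  exact VectorLattice.fundamentalTheorem_of_commRing hcont hlbp hint
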